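/- Let $K$ be a commutative semiring with $0\neq 1$ that is positive ($a+b=0$ implies $a=b=0$, and $ab=0$ implies $a=0$ or $b=0$) and multiplicatively cancellative ($ab=ac$ and $a\neq 0$ imply $b=c$). Let $V$ be a finite set of variables, each variable $A\in V$ having a domain $\mathrm{Dom}(A)$ with at least two elements. A $V$-tuple is a map $t$ assigning to each $A\in V$ a value $t(A)\in\mathrm{Dom}(A)$, and $t[Y]$ is its restriction to $Y\subseteq V$. A relation is a finite non-empty set of $V$-tuples. A $K$-relation is a function $R$ from $V$-tuples to $K$ with finite non-empty support $R'=\{t: R(t)\neq 0\}$; for a tuple $u$ over $Y\subseteq V$ put $R(u)=\sum_{t[Y]=u}R(t)$. Write $XY$ for $X\cup Y$. A conditional independence (CI) is an expression $Y\perp Z\mid X$ with $X,Y,Z\subseteq V$ pairwise disjoint; it is saturated (an SCI) if $XYZ=V$. A $K$-relation $R$ satisfies it if $R(t[XY])\,R(t[XZ])=R(t[XYZ])\,R(t[X])$ for all $V$-tuples $t$. A functional dependency (FD) is an expression $X\to Y$ with $X,Y\subseteq V$; a relation satisfies it if any two of its tuples that agree on $X$ agree on $Y$, and a $K$-relation satisfies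 it if its support does. A multivalued dependency (MVD) $X\twoheadrightarrow Y$ is satisfied by a relation $R$ if for all $t,t'\in R$ with $t[X]=t'[X]$ there is $t''\in R$ with $t''[XY]=t'[XY]$ and $t''[V\setminus XY]=t[V\setminus XY]$. Let $\sigma^*$ be the MVD $X\twoheadrightarrow Y$ if $\sigma$ is an SCI $Y\perp Z\mid X$, and $\sigma^*=\sigma$ if $\sigma$ is an FD; let $\Sigma^*=\{\sigma^*:\sigma\in\Sigma\}$. A set of dependencies implies $\tau$ over a class of relations or $K$-relations if every member of the class that satisfies the set satisfies $\tau$. Consider the following rules for CIs and FDs over $V$, where $X,Y,Z,W\subseteq V$ are arbitrary subject to all the CIs displayed being well formed (pairwise disjoint sets). * (S1) $Y\perp\emptyset\mid X$. * (S2) If $Y\perp Z\mid X$, then $Z\perp Y\mid X$. * (S3) If $Y\perp ZW\mid X$, then $Y\perp Z\mid X$. * (S4) If $Y\perp ZW\mid X$, then $Y\perp W\mid XZ$. * (S5) If $Y\perp Z\mid X$ and $Y\perp W\mid XZ$, then $Y\perp ZW\mid X$. * (FD1) If $Y\subseteq X$, then $X\to Y$. * (FD2) If $X\to Y$, then $XZ\to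 YZ$. * (FD3) If $X\to Y$ and $Y\to Z$, then $X\to Z$. * (FD-CI1) If $X\to Y$, then $Y\perp Z\mid X$. * (FD-CI2) If $Y\perp Z\mid X$ and $XY\to Z$, then $X\to Z$. **Theorem.** Let $\Sigma\cup\{\tau\}$ be a set of SCIs and FDs over $V$. The following are equivalent: 1. $\tau$ can be derived from $\Sigma$ using (S1)–(S5), (FD1)–(FD3), (FD-CI1) and (FD-CI2), where derivations may use CIs over $V$ that are not saturated; 2. $\Sigma$ implies $\tau$ over $K$-relations; 3. $\Sigma^*$ implies $\tau^*$ over relations consisting of exactly two tuples; 4. $\Sigma^*$ implies $\tau^*$ over relations. -/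

import Mathlib

namespace SemiringRelation

/-! ### Semirings

Semirings are commutative and non-trivial: `[CommSemiring K] [Nontrivial K]`. Multiplicative
cancellativity (`a * b = a * c` and `a ≠ 0` imply `b = c`) is Mathlib's `IsCancelMulZero K`. -/

/-- A semiring is positive if `a + b = 0` forces `a = b = 0`, and it has no divisors of zero. -/
structure IsPositive (K : Type*) [CommSemiring K] : Prop where
  eq_zero_of_add_eq_zero : ∀ a b : K, a + b = 0 → a = 0 ∧ b = 0
  no_zero_divisors : ∀ a b : K, a * b = 0 → a = 0 ∨ b = 0

/-! ### Dependencies over a schema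

The schema is a finite type `V` of variables; sets of variables are finsets of `V`. -/

/-- Conditional independences `X ; Y | Z` (`Y` and `Z` are independent given `X`), for pairwise
disjoint `X`, `Y`, `Z`, and functional dependencies `X → Y`. -/
inductive Dep (V : Type*) : Type _ where
  | ci (X Y Z : Finset V) (hXY : Disjoint X Y) (hXZ : Disjoint X Z) (hYZ : Disjoint Y Z) : Dep V
  | fd (X Y : Finset V) : Dep V

/-- Saturated conditional independences (the three sets exhaust the schema) and functional
dependencies. -/
inductive SatDep (V : Type*) [Fintype V] [DecidableEq V] : Type _ where
  | sci (X Y Z : Finset V) (hXY : Disjoint X Y) (hXZ : Disjoint X Z) (hYZ : Disjoint Y Z)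
      (hV : X ∪ Y ∪ Z = Finset.univ) : SatDep V
  | fd (X Y : Finset V) : SatDep V

/-- Multivalued dependencies `X ↠ Y` and functional dependencies `X → Y`. -/
inductive DbDep (V : Type*) : Type _ where
  | mvd (X Y : Finset V) : DbDep V
  | fd (X Y : Finset V) : DbDep V

section

variable {V : Type*} [Fintype V] [DecidableEq V]

/-- A saturated CI is in particular a CI. -/
def SatDep.toDep : SatDep V → Dep V
  | .sci X Y Z hXY hXZ hYZ _ => .ci X Y Z hXY hXZ hYZ
  | .fd X Y => .fd X Y

/-- The operation `σ ↦ σ*`: a saturated CI `X ; Y | Z` goes to the MVD `X ↠ Y`, and an FD to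
itself. -/
def SatDep.star : SatDep V → DbDep V
  | .sci X Y _ _ _ _ _ => .mvd X Y
  | .fd X Y => .fd X Y

end

/-! ### Derivability -/

/-- Derivability of a dependency from a set of dependencies with the semigraphoid axioms, the
Armstrong axioms, and the two combination rules. All CIs in a derivation (not necessarily
saturated) are built from pairwise disjoint sets of variables of the schema. -/
inductive Derivable {V : Type*} [DecidableEq V] (S : Set (Dep V)) : Dep V → Prop where
  | hyp (σ : Dep V) : σ ∈ S → Derivable S σ
  -- (S1) Triviality
  | triviality (X Y : Finset V) (h₁ : Disjoint X Y) (h₂ : Disjoint X ∅) (h₃ : Disjoint Y ∅) :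
      Derivable S (.ci X Y ∅ h₁ h₂ h₃)
  -- (S2) Symmetry
  | symmetry (X Y Z : Finset V) (h₁ : Disjoint X Y) (h₂ : Disjoint X Z) (h₃ : Disjoint Y Z)
      (h₄ : Disjoint Z Y) :
      Derivable S (.ci X Y Z h₁ h₂ h₃) → Derivable S (.ci X Z Y h₂ h₁ h₄)
  -- (S3) Decomposition
  | decomposition (X Y Z W : Finset V) (h₁ : Disjoint X Y) (h₂ : Disjoint X (Z ∪ W))
      (h₃ : Disjoint Y (Z ∪ W)) (h₄ : Disjoint X Z) (h₅ : Disjoint Y Z) :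
      Derivable S (.ci X Y (Z ∪ W) h₁ h₂ h₃) → Derivable S (.ci X Y Z h₁ h₄ h₅)
  -- (S4) Weak union
  | weakUnion (X Y Z W : Finset V) (h₁ : Disjoint X Y) (h₂ : Disjoint X (Z ∪ W))
      (h₃ : Disjoint Y (Z ∪ W)) (h₄ : Disjoint (X ∪ Z) Y) (h₅ : Disjoint (X ∪ Z) W)
      (h₆ : Disjoint Y W) :
      Derivable S (.ci X Y (Z ∪ W) h₁ h₂ h₃) → Derivable S (.ci (X ∪ Z) Y W h₄ h₅ h₆)
  -- (S5) Contraction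
  | contraction (X Y Z W : Finset V) (h₁ : Disjoint X Y) (h₂ : Disjoint X Z) (h₃ : Disjoint Y Z)
      (h₄ : Disjoint (X ∪ Z) Y) (h₅ : Disjoint (X ∪ Z) W) (h₆ : Disjoint Y W)
      (h₇ : Disjoint X (Z ∪ W)) (h₈ : Disjoint Y (Z ∪ W)) :
      Derivable S (.ci X Y Z h₁ h₂ h₃) → Derivable S (.ci (X ∪ Z) Y W h₄ h₅ h₆) →
      Derivable S (.ci X Y (Z ∪ W) h₁ h₇ h₈)
  -- (FD1) Triviality
  | fdTriviality (X Y : Finset V) : Y ⊆ X → Derivable S (.fd X Y)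
  -- (FD2) Augmentation
  | fdAugmentation (X Y Z : Finset V) :
      Derivable S (.fd X Y) → Derivable S (.fd (X ∪ Z) (Y ∪ Z))
  -- (FD3) Transitivity
  | fdTransitivity (X Y Z : Finset V) :
      Derivable S (.fd X Y) → Derivable S (.fd Y Z) → Derivable S (.fd X Z)
  -- (FD-CI1) CI introduction
  | ciIntroduction (X Y Z : Finset V) (h₁ : Disjoint X Y) (h₂ : Disjoint X Z)
      (h₃ : Disjoint Y Z) :
      Derivable S (.fd X Y) → Derivable S (.ci X Y Z h₁ h₂ h₃)
  -- (FD-CI2) FD contraction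
  | fdContraction (X Y Z : Finset V) (h₁ : Disjoint X Y) (h₂ : Disjoint X Z)
      (h₃ : Disjoint Y Z) :
      Derivable S (.ci X Y Z h₁ h₂ h₃) → Derivable S (.fd (X ∪ Y) Z) → Derivable S (.fd X Z)

/-! ### Relations and `K`-relations

The variable `A` has domain `Dom A`. A `V`-tuple is an element of `(A : V) → Dom A`, and its
projection on `Y` is `Y.restrict t : (A : Y) → Dom A`. -/

/-- The type of tuples over the whole schema. -/
abbrev Tup {V : Type*} (Dom : V → Type*) : Type _ := (A : V) → Dom A

section

variable {V : Type*} [Fintype V] [DecidableEq V] {Dom : V → Type*} {K : Type*} [CommSemiring K]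

/-- Satisfaction of the FD `X → Y` by a (finite) relation. -/
def SatisfiesFD (R : Finset (Tup Dom)) (X Y : Finset V) : Prop :=
  ∀ t ∈ R, ∀ t' ∈ R, X.restrict t = X.restrict t' → Y.restrict t = Y.restrict t'

/-- Satisfaction of the MVD `X ↠ Y` by a (finite) relation. -/
def SatisfiesMVD (R : Finset (Tup Dom)) (X Y : Finset V) : Prop :=
  ∀ t ∈ R, ∀ t' ∈ R, X.restrict t = X.restrict t' →
    ∃ t'' ∈ R, (X ∪ Y).restrict t'' = (X ∪ Y).restrict t' ∧
      ((X ∪ Y)ᶜ).restrict t'' = ((X ∪ Y)ᶜ).restrict t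

/-- Satisfaction of an MVD or FD by a relation. -/
def DbDep.SatisfiedBy (R : Finset (Tup Dom)) : DbDep V → Prop
  | .mvd X Y => SatisfiesMVD R X Y
  | .fd X Y => SatisfiesFD R X Y

/-- The marginal of the finitely supported function `R : Tup Dom → K` over the `Y`-tuple `u`: the
sum of the values `R t` over the tuples `t` whose projection on `Y` is `u` (only finitely many
terms are non-zero). -/
noncomputable def marginal (R : Tup Dom →₀ K) (Y : Finset V) (u : (A : Y) → Dom A) : K :=
  open Classical in ∑ t ∈ R.support.filter (fun t => Y.restrict t = u), R t

/-- Satisfaction of the CI `X ; Y | Z`: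
`R(t[XY]) R(t[XZ]) = R(t[XYZ]) R(t[X])` for all tuples `t`. -/
def SatisfiesCI (R : Tup Dom →₀ K) (X Y Z : Finset V) : Prop :=
  ∀ t : Tup Dom,
    marginal R (X ∪ Y) ((X ∪ Y).restrict t) * marginal R (X ∪ Z) ((X ∪ Z).restrict t) =
      marginal R (X ∪ Y ∪ Z) ((X ∪ Y ∪ Z).restrict t) * marginal R X (X.restrict t)

/-- Satisfaction of a CI or FD by a `K`-relation. An FD is evaluated on the support. -/
def Dep.SatisfiedBy (R : Tup Dom →₀ K) : Dep V → Prop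
  | .ci X Y Z _ _ _ => SatisfiesCI R X Y Z
  | .fd X Y => SatisfiesFD R.support X Y

variable (Dom) in
/-- Implication over `K`-relations. A `K`-relation is a function from tuples to `K` with finite and
non-empty support. -/
def ImpliesOverK (K : Type*) [CommSemiring K] (S : Set (Dep V)) (τ : Dep V) : Prop :=
  ∀ R : Tup Dom →₀ K, R.support.Nonempty → (∀ σ ∈ S, σ.SatisfiedBy R) → τ.SatisfiedBy R

variable (Dom) in
/-- Implication over relations. A relation is a finite non-empty set of tuples. -/
def ImpliesOverRel (S : Set (DbDep V)) (τ : DbDep V) : Prop :=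
  ∀ R : Finset (Tup Dom), R.Nonempty → (∀ σ ∈ S, σ.SatisfiedBy R) → τ.SatisfiedBy R

variable (Dom) in
/-- Implication over relations consisting of two tuples. -/
def ImpliesOverTwoTuple (S : Set (DbDep V)) (τ : DbDep V) : Prop :=
  ∀ R : Finset (Tup Dom), R.card = 2 → (∀ σ ∈ S, σ.SatisfiedBy R) → τ.SatisfiedBy R

end

end SemiringRelation

open SemiringRelation

namespace SemiringRelation

/-! ### Derivability of independence statements -/

section Derivability

variable {V : Type*} [DecidableEq V] {S : Set (Dep V)} {X Y Z W : Finset V}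

/-! The heart is completeness, 3 ⇒ 1. A relation of two tuples matters only through the set `C` of
variables on which they agree: there an SCI says that if `C` contains the condition, it contains one
of the two sides. If `τ` is not derivable, take `C` maximal among the sets containing the left side
of `τ` for which `τ`, with its left side replaced by `C` (and `C` removed from its two sides if it
is a CI), is not derivable. Were some `σ ∈ S` to fail at `C`, maximality would make `τ` derivable
over larger sets, and the rules would combine these derivations into one over `C` (`glue`,
`of_fd_condition`). So two tuples agreeing exactly on `C` refute `τ`.

Soundness gives 1 ⇒ 2: positivity makes a marginal non-zero exactly on projections of the support,
and cancellation handles weak union and contraction. For 1 ⇒ 4, soundness is applied over the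
Boolean semiring, realised as `Ideal ℚ`, where a saturated CI is the MVD on the support. For 2 ⇒ 3,
an MVD coming from an SCI reduces on two tuples to one of two FDs, which yields the CI over any
positive semiring. -/

lemma Derivable.fd_of_fd_union (h : Derivable S (.fd X Y)) (h' : Derivable S (.fd (X ∪ Y) Z)) :
    Derivable S (.fd X Z) := by
  have h₁ := h.fdAugmentation X Y X
  rw [Finset.union_self, Finset.union_comm Y] at h₁
  exact .fdTransitivity _ _ _ h₁ h'

lemma Derivable.fd_mono (h : Derivable S (.fd X Y)) (hX : X ⊆ Z) (hY : W ⊆ Y) :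
    Derivable S (.fd Z W) :=
  .fdTransitivity _ _ _ (.fdTriviality _ _ hX) (.fdTransitivity _ _ _ h (.fdTriviality _ _ hY))

/-- The sets are pairwise disjoint and the CI `X ; Y | Z` is derivable. -/
def DerivableCI (S : Set (Dep V)) (X Y Z : Finset V) : Prop :=
  ∃ (h₁ : Disjoint X Y) (h₂ : Disjoint X Z) (h₃ : Disjoint Y Z), Derivable S (.ci X Y Z h₁ h₂ h₃)

namespace DerivableCI

lemma empty_right (h : Disjoint X Y) : DerivableCI S X Y ∅ :=
  ⟨h, Finset.disjoint_empty_right X, Finset.disjoint_empty_right Y, .triviality ..⟩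

lemma symm (h : DerivableCI S X Y Z) : DerivableCI S X Z Y := by
  obtain ⟨h₁, h₂, h₃, h⟩ := h
  exact ⟨h₂, h₁, h₃.symm, .symmetry _ _ _ h₁ h₂ h₃ _ h⟩

lemma empty_left (h : Disjoint X Z) : DerivableCI S X ∅ Z := (empty_right h).symm

lemma mono_right (h : DerivableCI S X Y Z) (hW : W ⊆ Z) : DerivableCI S X Y W := by
  obtain ⟨h₁, h₂, h₃, h⟩ := h
  have e : W ∪ Z = Z := Finset.union_eq_right.2 hW
  refine ⟨h₁, h₂.mono_right hW, h₃.mono_right hW,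
    .decomposition X Y W Z h₁ (e.symm ▸ h₂) (e.symm ▸ h₃) _ _ ?_⟩
  simpa only [e] using h

lemma weakUnion (h : DerivableCI S X Y Z) (hW : W ⊆ Z) : DerivableCI S (X ∪ W) Y (Z \ W) := by
  obtain ⟨h₁, h₂, h₃, h⟩ := h
  have e : W ∪ Z \ W = Z := Finset.union_sdiff_of_subset hW
  have h₄ : Disjoint (X ∪ W) Y := Finset.disjoint_union_left.2 ⟨h₁, (h₃.mono_right hW).symm⟩
  have h₅ : Disjoint (X ∪ W) (Z \ W) :=
    Finset.disjoint_union_left.2 ⟨h₂.mono_right Finset.sdiff_subset, Finset.disjoint_sdiff⟩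
  have h₆ : Disjoint Y (Z \ W) := h₃.mono_right Finset.sdiff_subset
  refine ⟨h₄, h₅, h₆, .weakUnion X Y W (Z \ W) h₁ (e.symm ▸ h₂) (e.symm ▸ h₃) h₄ h₅ h₆ ?_⟩
  simpa only [e] using h

lemma contraction (h : DerivableCI S X Y Z) (h' : DerivableCI S (X ∪ Z) Y W) :
    DerivableCI S X Y (Z ∪ W) := by
  obtain ⟨h₁, h₂, h₃, h⟩ := h
  obtain ⟨h₄, h₅, h₆, h'⟩ := h'
  exact ⟨h₁, Finset.disjoint_union_right.2 ⟨h₂, (Finset.disjoint_union_left.1 h₅).1⟩,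
    Finset.disjoint_union_right.2 ⟨h₃, h₆⟩, .contraction _ _ _ _ h₁ h₂ h₃ h₄ h₅ h₆ _ _ h h'⟩

lemma contraction_left (h : DerivableCI S X Y Z) (h' : DerivableCI S (X ∪ Y) W Z) :
    DerivableCI S X (Y ∪ W) Z :=
  (h.symm.contraction h'.symm).symm

lemma of_fd (h : Derivable S (.fd X Y)) (h₁ : Disjoint X Y) (h₂ : Disjoint X Z)
    (h₃ : Disjoint Y Z) : DerivableCI S X Y Z :=
  ⟨h₁, h₂, h₃, .ciIntroduction _ _ _ _ _ _ h⟩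

lemma fd (h : DerivableCI S X Y Z) (h' : Derivable S (.fd (X ∪ Y) Z)) :
    Derivable S (.fd X Z) := by
  obtain ⟨h₁, h₂, h₃, h⟩ := h
  exact .fdContraction _ _ _ _ _ _ h h'

/-- The condition of a saturated CI can be enlarged arbitrarily. -/
lemma enlarge [Fintype V] (h : DerivableCI S X Y Z) (hV : X ∪ Y ∪ Z = Finset.univ)
    {C : Finset V} (hC : X ⊆ C) : DerivableCI S C (Y \ C) (Z \ C) := by
  have h' := ((h.weakUnion (W := Z ∩ C) Finset.inter_subset_left).symm.weakUnion
    (W := Y ∩ C) Finset.inter_subset_left).symm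
  -- Saturation is used here: what was moved into the condition fills up all of `C`.
  have e : X ∪ Z ∩ C ∪ Y ∩ C = C := by
    ext A
    have hA : A ∈ X ∪ Y ∪ Z := hV ▸ Finset.mem_univ A
    have := @hC A
    simp only [Finset.mem_union, Finset.mem_inter] at hA ⊢
    tauto
  rwa [e, Finset.sdiff_inter_self_left, Finset.sdiff_inter_self_left] at h'

/-- Two independences that decompose along a third one can be glued. -/
lemma glue {C P₁ P₂ Q₁ Q₂ : Finset V} (h : DerivableCI S C (P₁ ∪ Q₁) (P₂ ∪ Q₂))
    (hP : DerivableCI S (C ∪ (P₂ ∪ Q₂)) P₁ Q₁) (hQ : DerivableCI S (C ∪ (P₁ ∪ Q₁)) P₂ Q₂) :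
    DerivableCI S C (P₁ ∪ P₂) (Q₁ ∪ Q₂) := by
  -- Each of `P₁`, `P₂` becomes independent of everything outside its own block and of the other
  -- part of its block.
  have ha : DerivableCI S C P₁ (P₂ ∪ Q₂ ∪ Q₁) :=
    (h.symm.mono_right Finset.subset_union_left).symm.contraction hP
  have hb : DerivableCI S C P₂ (P₁ ∪ Q₁ ∪ Q₂) :=
    (h.mono_right Finset.subset_union_left).symm.contraction hQ
  have h₁ : DerivableCI S C P₁ (Q₁ ∪ Q₂) := ha.mono_right (by
    intro A; simp only [Finset.mem_union]; tauto)
  refine h₁.contraction_left ((hb.weakUnion (W := P₁) (by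
    intro A; simp only [Finset.mem_union]; tauto)).mono_right ?_)
  have hd := h₁.2.2.1
  intro A hA
  have : A ∉ P₁ := fun h' => Finset.disjoint_left.1 hd h' hA
  simp only [Finset.mem_union, Finset.mem_sdiff] at hA ⊢
  tauto

/-- Functionally determined variables can be removed from the condition. -/
lemma of_fd_condition {C D : Finset V} (hCD : C ⊆ D) (hf : Derivable S (.fd C D))
    (hY : Disjoint C Y) (hZ : Disjoint C Z) (hYZ : Disjoint Y Z)
    (h : DerivableCI S D (Y \ D) (Z \ D)) (hD : D ⊆ C ∪ Y ∪ Z) : DerivableCI S C Y Z := by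
  have hsub {U : Finset V} (hU : U ⊆ D) : Derivable S (.fd C U) :=
    .fdTransitivity _ _ _ hf (.fdTriviality _ _ hU)
  -- The determined parts `Y ∩ D` and `Z ∩ D` are independent of anything by FD-CI1; once both are
  -- in the condition, it equals `D` and `h` applies.
  have h₁ : DerivableCI S C (Y ∩ D) Z :=
    of_fd (hsub Finset.inter_subset_right) (hY.mono_right Finset.inter_subset_left) hZ
      (hYZ.mono_left Finset.inter_subset_left)
  have h₂ : DerivableCI S (C ∪ Y ∩ D) (Y \ D) (Z ∩ D) := by
    refine (of_fd (.fdTransitivity _ C _ (.fdTriviality _ _ Finset.subset_union_left)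
      (hsub Finset.inter_subset_right)) ?_ ?_ ?_).symm
    · exact (Finset.disjoint_union_left.2 ⟨hZ, hYZ.mono_left Finset.inter_subset_left⟩).mono_right
        Finset.inter_subset_left
    · refine Finset.disjoint_union_left.2 ⟨hY.mono_right Finset.sdiff_subset, ?_⟩
      exact Finset.disjoint_sdiff.mono_left Finset.inter_subset_right
    · exact Finset.disjoint_sdiff.mono_left Finset.inter_subset_right
  have e : C ∪ Y ∩ D ∪ Z ∩ D = D := by
    ext A
    have h₃ := @hCD A
    have h₄ := @hD A
    simp only [Finset.mem_union, Finset.mem_inter] at h₃ h₄ ⊢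
    tauto
  have h₃ := h₂.contraction (W := Z \ D) (by rwa [e])
  rw [Finset.union_comm (Z ∩ D), Finset.sdiff_union_inter] at h₃
  have h₄ := h₁.contraction_left h₃
  rwa [Finset.union_comm (Y ∩ D), Finset.sdiff_union_inter] at h₄

end DerivableCI

end Derivability

/-! ### Two-tuple models

A relation of two tuples is determined, as far as dependencies are concerned, by the set `C` of
variables on which the tuples agree. -/

section Model

variable {V : Type*} [Fintype V] [DecidableEq V]

/-- Satisfaction of a dependency by a pair of tuples that agree exactly on `C`. -/
def SatDep.HoldsAt (C : Finset V) : SatDep V → Prop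
  | .sci X Y Z _ _ _ _ => X ⊆ C → Y ⊆ C ∨ Z ⊆ C
  | .fd X Y => X ⊆ C → Y ⊆ C

/-- Completeness in combinatorial form: a maximal `C` at which `τ` stays underivable is closed under
`S`. -/
lemma exists_model_of_not_derivable {S : Set (SatDep V)} {τ : SatDep V}
    (hτ : ¬ Derivable (SatDep.toDep '' S) τ.toDep) :
    ∃ C : Finset V, (∀ σ ∈ S, σ.HoldsAt C) ∧ ¬ τ.HoldsAt C := by
  set T := SatDep.toDep '' S with hT
  have hypFD {U W} (h : SatDep.fd U W ∈ S) : Derivable T (.fd U W) := .hyp _ ⟨_, h, rfl⟩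
  have hypCI {U P Q h₁ h₂ h₃ hV} (h : SatDep.sci U P Q h₁ h₂ h₃ hV ∈ S) : DerivableCI T U P Q :=
    ⟨h₁, h₂, h₃, .hyp _ ⟨_, h, rfl⟩⟩
  have closeFD {U W C} (h : SatDep.fd U W ∈ S) (hU : U ⊆ C) : Derivable T (.fd C (C ∪ W)) := by
    have h' := Derivable.fdAugmentation _ _ C (hypFD h)
    rwa [Finset.union_eq_right.2 hU, Finset.union_comm W] at h'
  have notLE {C W : Finset V} (h : ¬ W ⊆ C) : ¬ C ∪ W ≤ C :=
    fun h' => h (Finset.subset_union_right.trans h')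
  cases τ with
  | fd X Y =>
    obtain ⟨C, hXC, ⟨hC, hmax⟩⟩ := (Set.toFinite {C : Finset V | ¬ Derivable T (.fd C Y)}
      ).exists_le_maximal hτ
    have hmax' {W : Finset V} (hW : ¬ W ⊆ C) : Derivable T (.fd (C ∪ W) Y) := by
      by_contra h
      exact notLE hW (hmax h Finset.subset_union_left)
    refine ⟨C, ?_, fun h => hC (.fdTriviality _ _ (h hXC))⟩
    rintro (⟨U, P, Q, h₁, h₂, h₃, hV⟩ | ⟨U, W⟩) hσ hU
    · by_contra! hPQ
      have hI := (hypCI hσ).enlarge hV hU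
      -- By maximality `C ∪ P` determines `Y`, so FD-CI2 lets `C` alone determine the part of `Y` in
      -- `Q`; symmetrically for `P`.
      have h₄ : Derivable T (.fd C ((Q \ C) ∩ Y)) := by
        refine (hI.mono_right Finset.inter_subset_left).fd ?_
        rw [Finset.union_sdiff_self_eq_union]
        exact (hmax' hPQ.1).fd_mono subset_rfl Finset.inter_subset_right
      have h₅ : Derivable T (.fd C ((P \ C) ∩ Y)) := by
        refine (hI.symm.mono_right Finset.inter_subset_left).fd ?_
        rw [Finset.union_sdiff_self_eq_union]
        exact (hmax' hPQ.2).fd_mono subset_rfl Finset.inter_subset_right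
      refine hC (h₄.fd_of_fd_union ((h₅.fd_mono Finset.subset_union_left
        subset_rfl).fd_of_fd_union (.fdTriviality _ _ fun A hA => ?_)))
      have hA' : A ∈ U ∪ P ∪ Q := hV ▸ Finset.mem_univ A
      have := @hU A
      simp only [Finset.mem_union, Finset.mem_inter, Finset.mem_sdiff] at hA' ⊢
      tauto
    · by_contra hW
      exact hC (.fdTransitivity _ _ _ (closeFD hσ hU) (hmax' hW))
  | sci X Y Z hXY hXZ hYZ hV =>
    obtain ⟨C, hXC, ⟨hC, hmax⟩⟩ := (Set.toFinite
      {C : Finset V | ¬ DerivableCI T C (Y \ C) (Z \ C)}).exists_le_maximal (a := X) (by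
        rw [Set.mem_ofPred_eq, Finset.sdiff_eq_self_of_disjoint hXY.symm,
          Finset.sdiff_eq_self_of_disjoint hXZ.symm]
        rintro ⟨_, _, _, h⟩
        exact hτ h)
    have hmax' {W : Finset V} (hW : ¬ W ⊆ C) :
        DerivableCI T (C ∪ W) (Y \ (C ∪ W)) (Z \ (C ∪ W)) := by
      by_contra h
      exact notLE hW (hmax h Finset.subset_union_left)
    refine ⟨C, ?_, fun h => (h hXC).elim (fun hY => hC ?_) (fun hZ => hC ?_)⟩
    · rintro (⟨U, P, Q, h₁, h₂, h₃, hV'⟩ | ⟨U, W⟩) hσ hU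
      · by_contra! hPQ
        have hI := (hypCI hσ).enlarge hV' hU
        have hcov (A) : A ∈ U ∪ P ∪ Q := hV' ▸ Finset.mem_univ A
        have hcov' (A) : A ∈ X ∪ Y ∪ Z := hV ▸ Finset.mem_univ A
        -- `Y` and `Z` are cut along `P` and `Q`: over `C ∪ P` only the parts in `Q` remain, and
        -- conversely. The violated SCI separates the two blocks, as `glue` requires.
        have split {P Q : Finset V} (hcov : ∀ A, A ∈ U ∪ P ∪ Q) (hPQ : Disjoint P Q)
            (Y : Finset V) : Y \ (C ∪ P) = (Y ∩ Q) \ C := by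
          ext A
          have := hcov A
          have := @hU A
          have : A ∈ P → A ∉ Q := fun h h' => Finset.disjoint_left.1 hPQ h h'
          simp only [Finset.mem_union, Finset.mem_inter, Finset.mem_sdiff] at *
          tauto
        have cover (P : Finset V) : C ∪ ((Y ∩ P) \ C ∪ (Z ∩ P) \ C) = C ∪ P := by
          ext A
          have := hcov' A
          have := @hXC A
          simp only [Finset.mem_union, Finset.mem_inter, Finset.mem_sdiff] at *
          tauto
        have part (P : Finset V) : (Y ∩ P) \ C ∪ (Z ∩ P) \ C = P \ C := by
          ext A
          have := hcov' A
          have := @hXC A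
          simp only [Finset.mem_union, Finset.mem_inter, Finset.mem_sdiff] at *
          tauto
        have union (Y : Finset V) : (Y ∩ P) \ C ∪ (Y ∩ Q) \ C = Y \ C := by
          ext A
          have := hcov A
          have := @hU A
          simp only [Finset.mem_union, Finset.mem_inter, Finset.mem_sdiff] at *
          tauto
        have hP := hmax' hPQ.1
        have hQ := hmax' hPQ.2
        rw [split hcov h₃, split hcov h₃] at hP
        rw [split (by simpa only [Finset.union_right_comm] using hcov) h₃.symm,
          split (by simpa only [Finset.union_right_comm] using hcov) h₃.symm] at hQ
        rw [← cover] at hP hQ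
        rw [← part P, ← part Q] at hI
        have := hI.glue hQ hP
        rw [union, union] at this
        exact hC this
      · by_contra hW
        have e (Y : Finset V) : (Y \ C) \ (C ∪ W) = Y \ (C ∪ W) := by
          rw [sdiff_sdiff, Finset.sup_eq_union, ← Finset.union_assoc, Finset.union_self]
        refine hC (.of_fd_condition Finset.subset_union_left (closeFD hσ hU) Finset.disjoint_sdiff
          Finset.disjoint_sdiff (hYZ.mono Finset.sdiff_subset Finset.sdiff_subset)
          (by rw [e, e]; exact hmax' hW) fun A _ => ?_)
        have hA : A ∈ X ∪ Y ∪ Z := hV ▸ Finset.mem_univ A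
        have := @hXC A
        simp only [Finset.mem_union, Finset.mem_sdiff] at *
        tauto
    · rw [Finset.sdiff_eq_empty_iff_subset.2 hY]
      exact .empty_left Finset.disjoint_sdiff
    · rw [Finset.sdiff_eq_empty_iff_subset.2 hZ]
      exact .empty_right Finset.disjoint_sdiff

end Model

/-! ### Marginals -/

section Marginal

variable {V : Type*} {Dom : V → Type*}

lemma restrict_eq_iff {X : Finset V} {t t' : Tup Dom} :
    X.restrict t = X.restrict t' ↔ ∀ A ∈ X, t A = t' A := by
  simp [funext_iff]

lemma restrict_eq_of_subset {X Y : Finset V} (h : X ⊆ Y) {t t' : Tup Dom}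
    (ht : Y.restrict t = Y.restrict t') : X.restrict t = X.restrict t' :=
  restrict_eq_iff.2 fun A hA => restrict_eq_iff.1 ht A (h hA)

lemma restrict_union_eq_iff [DecidableEq V] {X Y : Finset V} {t t' : Tup Dom} :
    (X ∪ Y).restrict t = (X ∪ Y).restrict t' ↔
      X.restrict t = X.restrict t' ∧ Y.restrict t = Y.restrict t' := by
  simp only [restrict_eq_iff, Finset.mem_union]
  exact ⟨fun h => ⟨fun A hA => h A (.inl hA), fun A hA => h A (.inr hA)⟩,
    fun h A hA => hA.elim (h.1 A) (h.2 A)⟩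

lemma restrict_updateFinset_self [DecidableEq V] {X : Finset V} (t : Tup Dom)
    (u : (A : X) → Dom A) : X.restrict (Function.updateFinset t X u) = u :=
  funext fun A => dif_pos A.2

lemma restrict_updateFinset_of_disjoint [DecidableEq V] {X Y : Finset V} (h : Disjoint X Y)
    (t : Tup Dom) (u : (A : X) → Dom A) :
    Y.restrict (Function.updateFinset t X u) = Y.restrict t :=
  restrict_eq_iff.2 fun _ hA => dif_neg (Finset.disjoint_right.1 h hA)

variable {K : Type*} [CommSemiring K] {R : Tup Dom →₀ K}

lemma marginal_congr_support {X Y : Finset V} {t : Tup Dom}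
    (h : ∀ s ∈ R.support, X.restrict s = X.restrict t ↔ Y.restrict s = Y.restrict t) :
    marginal R X (X.restrict t) = marginal R Y (Y.restrict t) := by
  classical
  unfold marginal
  congr 1
  exact Finset.filter_congr h

lemma IsPositive.sum_eq_zero (hK : IsPositive K) {ι : Type*} {s : Finset ι} {f : ι → K}
    (h : ∑ i ∈ s, f i = 0) : ∀ i ∈ s, f i = 0 := by
  classical
  induction s using Finset.induction_on with
  | empty => simp
  | insert i s hi ih =>
    rw [Finset.sum_insert hi] at h
    have h' := hK.eq_zero_of_add_eq_zero _ _ h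
    intro j hj
    obtain rfl | hj := Finset.mem_insert.1 hj
    · exact h'.1
    · exact ih h'.2 j hj

/-- Non-zero summands cannot cancel in a positive semiring. -/
lemma marginal_ne_zero_iff (hK : IsPositive K) {X : Finset V} {t : Tup Dom} :
    marginal R X (X.restrict t) ≠ 0 ↔ ∃ s ∈ R.support, X.restrict s = X.restrict t := by
  classical
  constructor
  · intro h
    obtain ⟨s, hs, -⟩ := Finset.exists_ne_zero_of_sum_ne_zero h
    exact ⟨s, (Finset.mem_filter.1 hs).1, (Finset.mem_filter.1 hs).2⟩
  · rintro ⟨s, hs, hst⟩ h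
    refine Finsupp.mem_support_iff.1 hs (hK.sum_eq_zero h s ?_)
    exact Finset.mem_filter.2 ⟨hs, hst⟩

lemma marginal_eq_zero_of_subset (hK : IsPositive K) {X Y : Finset V} (h : X ⊆ Y) {t : Tup Dom}
    (ht : marginal R X (X.restrict t) = 0) : marginal R Y (Y.restrict t) = 0 := by
  by_contra hY
  obtain ⟨s, hs, hst⟩ := (marginal_ne_zero_iff hK).1 hY
  exact (marginal_ne_zero_iff hK).2 ⟨s, hs, restrict_eq_of_subset h hst⟩ ht

/-- Each marginal is the sum of the marginals over the extensions by values on further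
variables. -/
lemma exists_marginal_eq_sum [DecidableEq V] (R : Tup Dom →₀ K) (W : Finset V) :
    ∃ I : Finset ((A : W) → Dom A), ∀ X : Finset V, Disjoint W X → ∀ t : Tup Dom,
      marginal R X (X.restrict t) =
        ∑ u ∈ I, marginal R (X ∪ W) ((X ∪ W).restrict (Function.updateFinset t W u)) := by
  classical
  -- This index set depends on neither `X` nor `t`, so different marginals can be summed over the
  -- same values.
  refine ⟨R.support.image W.restrict, fun X hX t => ?_⟩
  unfold marginal
  rw [← Finset.sum_fiberwise_of_maps_to (g := W.restrict) (t := R.support.image W.restrict)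
    fun s hs => Finset.mem_image_of_mem _ (Finset.mem_filter.1 hs).1]
  refine Finset.sum_congr rfl fun u _ => ?_
  rw [Finset.filter_filter]
  congr 1
  refine Finset.filter_congr fun s _ => ?_
  rw [restrict_union_eq_iff, restrict_updateFinset_of_disjoint hX,
    restrict_updateFinset_self]

/-- The `K`-relation that annotates each tuple of a relation with `1`. -/
noncomputable def annotateOne (K : Type*) [CommSemiring K] (R : Finset (Tup Dom)) :
    Tup Dom →₀ K :=
  Finsupp.indicator R fun _ _ => 1

lemma support_annotateOne [Nontrivial K] (R : Finset (Tup Dom)) :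
    (annotateOne K R).support = R := by
  classical
  ext t
  simp [annotateOne, Finsupp.indicator_apply]

end Marginal

/-! ### Soundness -/

section Soundness

variable {V : Type*} [DecidableEq V] {Dom : V → Type*} {K : Type*} [CommSemiring K]
  {R : Tup Dom →₀ K} {X Y Z W : Finset V}

/-- Overwriting `s` on `Z` by `s'` gives a tuple with both left-hand marginals non-zero; without
zero divisors its `XYZ`-marginal is non-zero, hence witnessed in the support. -/
lemma SatisfiesCI.exists_amalgam (hK : IsPositive K) (hYZ : Disjoint Y Z) (hXZ : Disjoint X Z)
    (h : SatisfiesCI R X Y Z) {s s' : Tup Dom} (hs : s ∈ R.support) (hs' : s' ∈ R.support)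
    (hss' : X.restrict s = X.restrict s') :
    ∃ r ∈ R.support, (X ∪ Y).restrict r = (X ∪ Y).restrict s ∧ Z.restrict r = Z.restrict s' := by
  set t := Function.updateFinset s Z (Z.restrict s')
  have hZ : Z.restrict t = Z.restrict s' := restrict_updateFinset_self _ _
  have hXY : (X ∪ Y).restrict t = (X ∪ Y).restrict s := restrict_updateFinset_of_disjoint
    (Finset.disjoint_union_right.2 ⟨hXZ.symm, hYZ.symm⟩) _ _
  have ht := h t
  have h₁ : marginal R (X ∪ Y) ((X ∪ Y).restrict t) ≠ 0 :=
    (marginal_ne_zero_iff hK).2 ⟨s, hs, hXY.symm⟩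
  have h₂ : marginal R (X ∪ Z) ((X ∪ Z).restrict t) ≠ 0 := by
    refine (marginal_ne_zero_iff hK).2 ⟨s', hs', restrict_union_eq_iff.2 ⟨?_, hZ.symm⟩⟩
    rw [← hss', (restrict_union_eq_iff.1 hXY).1]
  have h₃ : marginal R (X ∪ Y ∪ Z) ((X ∪ Y ∪ Z).restrict t) ≠ 0 := by
    intro h₃
    rw [h₃, zero_mul] at ht
    exact (hK.no_zero_divisors _ _ ht).elim h₁ h₂
  obtain ⟨r, hr, hrt⟩ := (marginal_ne_zero_iff hK).1 h₃
  rw [restrict_union_eq_iff, hXY, hZ] at hrt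
  exact ⟨r, hr, hrt⟩

lemma SatisfiesCI.symm (h : SatisfiesCI R X Y Z) : SatisfiesCI R X Z Y := fun t => by
  rw [mul_comm, h t, Finset.union_right_comm]

/-- Sum the given identity over the values on `W \ Z`, which the marginals on `X ∪ Y` and `X` do not
see. -/
lemma SatisfiesCI.decomposition (hX : Disjoint X (Z ∪ W)) (hY : Disjoint Y (Z ∪ W))
    (h : SatisfiesCI R X Y (Z ∪ W)) : SatisfiesCI R X Y Z := by
  obtain ⟨I, hI⟩ := exists_marginal_eq_sum R (W \ Z)
  have hWZ : W \ Z ⊆ Z ∪ W := Finset.sdiff_subset.trans Finset.subset_union_right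
  have dX : Disjoint (W \ Z) X := (hX.mono_right hWZ).symm
  have dXY : Disjoint (W \ Z) (X ∪ Y) :=
    Finset.disjoint_union_right.2 ⟨dX, (hY.mono_right hWZ).symm⟩
  intro t
  rw [hI (X ∪ Z) (Finset.disjoint_union_right.2 ⟨dX, Finset.sdiff_disjoint⟩),
    hI (X ∪ Y ∪ Z) (Finset.disjoint_union_right.2 ⟨dXY, Finset.sdiff_disjoint⟩),
    Finset.mul_sum, Finset.sum_mul]
  refine Finset.sum_congr rfl fun u _ => ?_
  have h' := h (Function.updateFinset t (W \ Z) u)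
  rwa [restrict_updateFinset_of_disjoint dXY, restrict_updateFinset_of_disjoint dX,
    ← Finset.union_sdiff_self_eq_union (s := Z), ← Finset.union_assoc, ← Finset.union_assoc] at h'

/-- Multiply by the marginal on `X`, use the hypothesis and its decomposition, and cancel; if that
factor is zero, all finer marginals vanish. -/
lemma SatisfiesCI.weakUnion (hK : IsPositive K) [IsCancelMulZero K] (hX : Disjoint X (Z ∪ W))
    (hY : Disjoint Y (Z ∪ W)) (h : SatisfiesCI R X Y (Z ∪ W)) : SatisfiesCI R (X ∪ Z) Y W := by
  intro t
  have h₁ := h t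
  have h₂ := h.decomposition hX hY t
  rw [← Finset.union_assoc, ← Finset.union_assoc, Finset.union_right_comm X Y Z] at h₁
  rw [Finset.union_right_comm X Y Z] at h₂
  by_cases h₀ : marginal R X (X.restrict t) = 0
  · rw [marginal_eq_zero_of_subset hK (Finset.subset_union_left.trans Finset.subset_union_left) h₀,
      marginal_eq_zero_of_subset hK (Y := X ∪ Z) Finset.subset_union_left h₀, zero_mul, mul_zero]
  · refine mul_right_cancel₀ h₀ ?_
    rw [mul_right_comm, ← h₂, mul_right_comm, h₁, mul_right_comm]

/-- Same argument, cancelling the marginal on `X ∪ Z`. -/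
lemma SatisfiesCI.contraction (hK : IsPositive K) [IsCancelMulZero K] (h : SatisfiesCI R X Y Z)
    (h' : SatisfiesCI R (X ∪ Z) Y W) : SatisfiesCI R X Y (Z ∪ W) := by
  intro t
  have h₁ := h t
  have h₂ := h' t
  rw [Finset.union_right_comm X Y Z] at h₁
  rw [← Finset.union_assoc, ← Finset.union_assoc, Finset.union_right_comm X Y Z]
  by_cases h₀ : marginal R (X ∪ Z) ((X ∪ Z).restrict t) = 0
  · rw [marginal_eq_zero_of_subset hK (Y := X ∪ Z ∪ W) Finset.subset_union_left h₀,
      marginal_eq_zero_of_subset hK (Y := X ∪ Z ∪ Y ∪ W)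
        (Finset.subset_union_left.trans Finset.subset_union_left) h₀, zero_mul, mul_zero]
  · refine mul_right_cancel₀ h₀ ?_
    rw [mul_right_comm, h₁, mul_right_comm, h₂, mul_right_comm]

/-- When the marginal on `X ∪ Y` is non-zero, support tuples matching `t` on `X` match it on `Y`, so
adjoining `Y` changes no marginal involved. -/
lemma SatisfiesFD.satisfiesCI (hK : IsPositive K) (h : SatisfiesFD R.support X Y) :
    SatisfiesCI R X Y Z := by
  intro t
  by_cases h₀ : marginal R (X ∪ Y) ((X ∪ Y).restrict t) = 0
  · rw [h₀, marginal_eq_zero_of_subset hK Finset.subset_union_left h₀, zero_mul, zero_mul]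
  · obtain ⟨s, hs, hst⟩ := (marginal_ne_zero_iff hK).1 h₀
    rw [restrict_union_eq_iff] at hst
    have hXY (r) (hr : r ∈ R.support) (hrt : X.restrict r = X.restrict t) :
        Y.restrict r = Y.restrict t := (h r hr s hs (hrt.trans hst.1.symm)).trans hst.2
    rw [mul_comm]
    congr 1
    · refine marginal_congr_support fun r hr => ?_
      have := hXY r hr
      simp only [restrict_union_eq_iff]
      tauto
    · refine marginal_congr_support fun r hr => ?_
      have := hXY r hr
      simp only [restrict_union_eq_iff]
      tauto

lemma Derivable.satisfiedBy (hK : IsPositive K) [IsCancelMulZero K] {S : Set (Dep V)}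
    (hS : ∀ σ ∈ S, σ.SatisfiedBy R) {τ : Dep V} (h : Derivable S τ) : τ.SatisfiedBy R := by
  induction h with
  | hyp σ hσ => exact hS σ hσ
  | triviality X Y => 
    intro t
    rw [Finset.union_empty, Finset.union_empty]
  | symmetry _ _ _ _ _ _ _ _ ih => exact SatisfiesCI.symm ih
  | decomposition _ _ _ _ _ h₂ h₃ _ _ _ ih => exact SatisfiesCI.decomposition h₂ h₃ ih
  | weakUnion _ _ _ _ _ h₂ h₃ _ _ _ _ ih => exact SatisfiesCI.weakUnion hK h₂ h₃ ih
  | contraction _ _ _ _ _ _ _ _ _ _ _ _ _ _ ih ih' => exact SatisfiesCI.contraction hK ih ih'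
  | fdTriviality X Y hYX => exact fun t _ t' _ h => restrict_eq_of_subset hYX h
  | fdAugmentation X Y Z _ ih =>
    intro t ht t' ht' h
    rw [restrict_union_eq_iff] at h ⊢
    exact ⟨ih t ht t' ht' h.1, h.2⟩
  | fdTransitivity X Y Z _ _ ih ih' =>
    exact fun t ht t' ht' h => ih' t ht t' ht' (ih t ht t' ht' h)
  | ciIntroduction _ _ _ _ _ _ _ ih => exact SatisfiesFD.satisfiesCI hK ih
  | fdContraction X Y Z _ h₂ h₃ _ _ ih ih' =>
    intro t ht t' ht' h
    -- `r` follows `t` on `X ∪ Y` and `t'` on `Z`, so the FD forces `t` and `t'` to agree on `Z`.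
    obtain ⟨r, hr, hrt, hrt'⟩ := SatisfiesCI.exists_amalgam hK h₃ h₂ ih ht ht' h
    rw [← hrt', ih' r hr t ht hrt]

end Soundness

/-! ### Relations and `K`-relations -/

section Transfer

variable {V : Type*} [Fintype V] [DecidableEq V] {Dom : V → Type*} {K : Type*} [CommSemiring K]

lemma compl_union_eq {X Y Z : Finset V} (hXZ : Disjoint X Z) (hYZ : Disjoint Y Z)
    (hV : X ∪ Y ∪ Z = Finset.univ) : (X ∪ Y)ᶜ = Z :=
  (IsCompl.of_eq (Finset.disjoint_iff_inter_eq_empty.1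
    (Finset.disjoint_union_left.2 ⟨hXZ, hYZ⟩)) hV).compl_eq

lemma SatDep.star_satisfiedBy_support (hK : IsPositive K) {R : Tup Dom →₀ K} {σ : SatDep V}
    (h : σ.toDep.SatisfiedBy R) : σ.star.SatisfiedBy R.support := by
  cases σ with
  | fd X Y => exact h
  | sci X Y Z hXY hXZ hYZ hV =>
    intro t ht t' ht' htt'
    rw [compl_union_eq hXZ hYZ hV]
    exact SatisfiesCI.exists_amalgam hK hYZ hXZ h ht' ht htt'.symm

/-- In a relation of two tuples, satisfaction depends on the agreement set only. -/
lemma SatDep.star_satisfiedBy_pair [DecidableEq (Tup Dom)] {t t' : Tup Dom} {C : Finset V}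
    (hC : ∀ A, t A = t' A ↔ A ∈ C) {σ : SatDep V} :
    σ.star.SatisfiedBy {t, t'} ↔ σ.HoldsAt C := by
  have agree {X : Finset V} : X.restrict t = X.restrict t' ↔ X ⊆ C := by
    simp only [restrict_eq_iff, hC]
    rfl
  have agree' {X : Finset V} : X.restrict t' = X.restrict t ↔ X ⊆ C := eq_comm.trans agree
  cases σ with
  | fd X Y =>
    change SatisfiesFD _ X Y ↔ (X ⊆ C → Y ⊆ C)
    simp [SatisfiesFD, agree, agree']
  | sci X Y Z hXY hXZ hYZ hV =>
    change SatisfiesMVD _ X Y ↔ (X ⊆ C → Y ⊆ C ∨ Z ⊆ C)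
    simp only [SatisfiesMVD, compl_union_eq hXZ hYZ hV, Finset.mem_insert, Finset.mem_singleton,
      forall_eq_or_imp, forall_eq, exists_eq_or_imp, exists_eq_left, agree, agree',
      Finset.union_subset_iff, true_and, and_true, forall_const]
    tauto

/-- With two tuples the MVD forces the FD `X → Y` or `X → Z`, and either one gives the CI. -/
lemma SatDep.toDep_satisfiedBy_of_card_eq_two [Nontrivial K] (hK : IsPositive K)
    {R : Finset (Tup Dom)} (hR : R.card = 2) {σ : SatDep V} (h : σ.star.SatisfiedBy R) :
    σ.toDep.SatisfiedBy (annotateOne K R) := by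
  cases σ with
  | fd X Y =>
    change SatisfiesFD _ X Y
    rwa [support_annotateOne]
  | sci X Y Z hXY hXZ hYZ hV =>
    classical
    obtain ⟨t, t', -, rfl⟩ := Finset.card_eq_two.1 hR
    have hC (A) : t A = t' A ↔ A ∈ Finset.univ.filter fun A => t A = t' A := by simp
    have fd {X Y : Finset V} (h : (SatDep.fd X Y).HoldsAt (Finset.univ.filter fun A => t A = t' A)) :
        SatisfiesFD (annotateOne K {t, t'}).support X Y := by
      rw [support_annotateOne]
      exact (SatDep.star_satisfiedBy_pair hC).2 h
    have h' := (SatDep.star_satisfiedBy_pair hC).1 h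
    by_cases hY : Y ⊆ Finset.univ.filter fun A => t A = t' A
    · exact (fd fun _ => hY).satisfiesCI hK
    · exact ((fd fun hX => (h' hX).resolve_left hY).satisfiesCI hK).symm

/-- A field has only the ideals `⊥` and `⊤`, so this is the Boolean semiring. -/
lemma isPositive_ideal : IsPositive (Ideal ℚ) where
  eq_zero_of_add_eq_zero I J h := by
    simpa using h
  no_zero_divisors I J h := mul_eq_zero.1 h

lemma SatDep.toDep_satisfiedBy_ideal {R : Finset (Tup Dom)} {σ : SatDep V}
    (h : σ.star.SatisfiedBy R) : σ.toDep.SatisfiedBy (annotateOne (Ideal ℚ) R) := by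
  cases σ with
  | fd X Y =>
    change SatisfiesFD _ X Y
    rwa [support_annotateOne]
  | sci X Y Z hXY hXZ hYZ hV =>
    -- With only two values, equality means being non-zero simultaneously, so the CI becomes a
    -- statement about the support.
    have ext_ne_zero {I J : Ideal ℚ} (h : I ≠ 0 ↔ J ≠ 0) : I = J := by
      rcases I.eq_bot_or_top with rfl | rfl <;> rcases J.eq_bot_or_top with rfl | rfl <;>
        simp_all
    intro t
    refine ext_ne_zero ?_
    simp only [mul_ne_zero_iff, marginal_ne_zero_iff isPositive_ideal, support_annotateOne]
    constructor
    · rintro ⟨⟨s, hs, hst⟩, ⟨s', hs', hst'⟩⟩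
      have hst₁ := restrict_union_eq_iff.1 hst
      have hst₂ := restrict_union_eq_iff.1 hst'
      obtain ⟨r, hr, hrs, hrs'⟩ := h s' hs' s hs (hst₂.1.trans hst₁.1.symm)
      rw [compl_union_eq hXZ hYZ hV] at hrs'
      exact ⟨⟨r, hr, restrict_union_eq_iff.2 ⟨hrs.trans hst, hrs'.trans hst₂.2⟩⟩, s, hs, hst₁.1⟩
    · rintro ⟨⟨s, hs, hst⟩, -⟩
      have hst₁ := restrict_union_eq_iff.1 hst
      exact ⟨⟨s, hs, hst₁.1⟩, s, hs, restrict_union_eq_iff.2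
        ⟨(restrict_union_eq_iff.1 hst₁.1).1, hst₁.2⟩⟩

end Transfer

end SemiringRelation

theorem theorem3 {K : Type*} [CommSemiring K] [Nontrivial K] (hpos : IsPositive K)
    (hcancel : IsCancelMulZero K) {V : Type*} [Fintype V] [DecidableEq V] (Dom : V → Type*)
    [∀ A, Nontrivial (Dom A)] (S : Set (SatDep V)) (τ : SatDep V) :
    List.TFAE [
      Derivable (SatDep.toDep '' S) τ.toDep,
      ImpliesOverK Dom K (SatDep.toDep '' S) τ.toDep,
      ImpliesOverTwoTuple Dom (SatDep.star '' S) τ.star,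
      ImpliesOverRel Dom (SatDep.star '' S) τ.star] := by
 
  classical
  tfae_have 1 → 2 := fun h R _ hR => h.satisfiedBy hpos hR
  tfae_have 1 → 4 := fun h R _ hR => by
    have h' := SatDep.star_satisfiedBy_support isPositive_ideal
      (h.satisfiedBy (R := annotateOne (Ideal ℚ) R) isPositive_ideal (by
        rintro _ ⟨σ, hσ, rfl⟩
        exact SatDep.toDep_satisfiedBy_ideal (hR _ ⟨σ, hσ, rfl⟩)))
    rwa [support_annotateOne] at h'
  tfae_have 4 → 3 := fun h R hR => h R (Finset.card_pos.1 (by omega))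
  tfae_have 2 → 3 := fun h R hR hS => by
    have h' := SatDep.star_satisfiedBy_support hpos (h (annotateOne K R)
      (by rw [support_annotateOne]; exact Finset.card_pos.1 (by omega)) (by
        rintro _ ⟨σ, hσ, rfl⟩
        exact SatDep.toDep_satisfiedBy_of_card_eq_two hpos hR (hS _ ⟨σ, hσ, rfl⟩)))
    rwa [support_annotateOne] at h'
  tfae_have 3 → 1 := fun h => by
    by_contra hτ
    obtain ⟨C, hS, hC⟩ := exists_model_of_not_derivable hτ
    choose a b hab using fun A => exists_pair_ne (Dom A)
    have hagree (A) : a A = (if A ∈ C then a A else b A) ↔ A ∈ C := by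
      by_cases hA : A ∈ C <;> simp [hA, hab A]
    -- The two tuples are distinct: otherwise `C` would contain every variable and `τ` would hold at
    -- `C`.
    refine hC ((SatDep.star_satisfiedBy_pair hagree).1 (h _ (Finset.card_pair fun he => hC ?_) ?_))
    · have hu (X : Finset V) : X ⊆ C := fun A _ => (hagree A).1 (congrFun he A)
      cases τ with
      | sci X Y Z => exact fun _ => .inl (hu Y)
      | fd X Y => exact fun _ => hu Y
    · rintro _ ⟨σ, hσ, rfl⟩
      exact (SatDep.star_satisfiedBy_pair hagree).2 (hS σ hσ)
  tfae_finish
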